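/- Let $K_\mu(x)=\int_0^\infty e^{-x\cosh u}\cosh(\mu u)\,du$ ($x>0$, $\mu\in\mathbb{C}$) denote the Macdonald function (modified Bessel function of the second kind). For $\nu\in\mathbb{R}$ and $1<p<\infty$ let $L_{\nu,p}(\mathbb{R}_+)$ be the space of (classes of) measurable functions $f$ on $\mathbb{R}_+=(0,\infty)$ with $\|f\|_{\nu,p}=\left(\int_0^\infty x^{\nu p-1}|f(x)|^p\,dx\right)^{1/p}<\infty$. Let $1<p\le 2$, $q=p/(p-1)$, $\alpha\ge 0$ and $\nu\in\mathbb{R}$ with $\alpha+\nu<1$. Then for every $f\in L_{\nu,p}(\mathbb{R}_+)$ the integral $$F_\alpha(\tau)=\int_0^\infty \left|K_{(i\tau+\alpha)/2}(x)\right|^2 f(x)\,dx,\qquad \tau\in\mathbb{R},$$ converges absolutely for all $\tau\in\mathbb{R}$, and $f\mapsto F_\alpha$ defines a compact linear operator from $L_{\nu,p}(\mathbb{R}_+)$ to $L_q(\mathbb{R})$. -/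

import Mathlib

open MeasureTheory Set

noncomputable section

/-- The Macdonald function (modified Bessel function of the second kind)
`K_μ(z) = ∫₀^∞ exp (-z cosh u) cosh (μ u) du`, for `Re z > 0` and every complex index `μ`
(only arguments with `Re z > 0`, where the integral converges absolutely, are meaningful). -/
def macdonaldK (μ z : ℂ) : ℂ :=
  ∫ u : ℝ in Ioi (0 : ℝ), Complex.exp (-z * Complex.cosh (u : ℂ)) * Complex.cosh (μ * (u : ℂ))

/-- The kernel `|K_{(iτ+α)/2}(x)|²`, for `x > 0`. -/
def lebedevKernel (α τ x : ℝ) : ℝ :=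
  ‖macdonaldK ((Complex.I * (τ : ℂ) + (α : ℂ)) / 2) (x : ℂ)‖ ^ 2

/-- The generalized Lebedev index transform
`F_α(τ) = ∫₀^∞ |K_{(iτ+α)/2}(x)|² f(x) dx`. -/
def lebedevTransform {𝕜 : Type*} [RCLike 𝕜] (α : ℝ) (f : ℝ → 𝕜) (τ : ℝ) : 𝕜 :=
  ∫ x in Ioi (0 : ℝ), lebedevKernel α τ x • f x

/-- The measure `x^(νp-1) dx` on the half-line `(0, ∞)` (extended by zero to `ℝ`). -/
def weightedMeasure (ν p : ℝ) : Measure ℝ :=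
  (volume.restrict (Ioi (0 : ℝ))).withDensity fun x => ENNReal.ofReal (x ^ (ν * p - 1))

/-- The weighted Lebesgue space `L_{ν,p}(ℝ₊)`, for finite `p`, with the norm
`(∫₀^∞ x^(νp-1) |f(x)|^p dx)^(1/p)`. -/
abbrev WeightedLp (𝕜 : Type*) [RCLike 𝕜] (ν p : ℝ) :=
  Lp 𝕜 (ENNReal.ofReal p) (weightedMeasure ν p)

end

/-!
The transform is an integral operator of Hille–Tamarkin type: its kernel, seen as a curve
`τ ↦ |K_{(iτ+α)/2}|²` in the dual of `L_{ν,p}(ℝ₊)`, is a `q`-integrable function of `τ`. Hölder's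
inequality then gives absolute convergence and boundedness, and compactness follows because every
element of the Bochner space `L^q(ℝ; G)` is a limit of simple functions, which induce operators of
finite rank (`isCompactOperator_compLpL₂_flip`).

What remains is to bound the kernel. With `a = α / 2` and `Re μ = a`, the integrand of `K_μ(x)` is at
most `exp (-x cosh u) exp (a u)`. Since `exp u ≤ 2 cosh u` and `t ^ s exp (-t)` is bounded by a
multiple of `exp (-t / 2)`, this is at most a multiple of `x ^ (-(a + 2δ)) exp (-x / 2) exp (-δ u)`,
even after multiplication by `x cosh u` or by `u` (`exists_exp_neg_mul_cosh_le`). Hence `K_μ(x)`, its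
modulus of continuity in `μ`, and, after one integration by parts in `u`, also `μ K_μ(x)` are all
controlled by the same weight in `x` (`exists_norm_macdonaldK_le`). Squaring, for every `b > α`,
`|K_{(iτ+α)/2}(x)|² ≤ C (1 + τ²)⁻¹ x ^ (-b) exp (-x)`, and the kernel is Lipschitz in `τ` with the
same weight. The weight `x ^ (-b) exp (-x)` lies in the dual of `L_{ν,p}(ℝ₊)` exactly when
`b + ν < 1`, and such a `b` exists because `α + ν < 1`.
-/

/-! ### Compactness of operators induced by `Lᵖ`-valued kernels -/

/-- An element `g` of the Bochner space `Lᵖ(μ; G)` induces, through a bounded bilinear form `B` on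
`E × G`, the operator `f ↦ B f (g ·)` from `E` to `Lᵖ(μ)`. It depends continuously on `g`, and has
rank at most one when `g` is the indicator of a set times a vector; as such `g` span a dense
subspace, the operator is always compact. -/
theorem isCompactOperator_compLpL₂_flip {X 𝕜 E G : Type*} [MeasurableSpace X] {μ : Measure X}
    [RCLike 𝕜] [NormedAddCommGroup E] [NormedSpace 𝕜 E] [NormedAddCommGroup G] [NormedSpace 𝕜 G]
    {p : ENNReal} [Fact (1 ≤ p)] (hp : p ≠ ⊤) (B : E →L[𝕜] G →L[𝕜] 𝕜) (g : Lp G p μ) :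
    IsCompactOperator ((B.compLpL₂ p μ).flip g) := by
  induction g using Lp.induction hp with
  | indicatorConst c hs hμs =>
    rename_i s
    -- the operator factors through the line spanned by the indicator of `s`
    have h : ((B.compLpL₂ p μ).flip (Lp.simpleFunc.indicatorConst p hs hμs.ne c)) =
        (ContinuousLinearMap.toSpanSingleton 𝕜 (indicatorConstLp p hs hμs.ne (1 : 𝕜))).comp
          (B.flip c) := by
      ext1 f
      simp only [ContinuousLinearMap.flip_apply, ContinuousLinearMap.compLpL₂_apply_apply,
        ContinuousLinearMap.comp_apply, ContinuousLinearMap.toSpanSingleton_apply,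
        Lp.simpleFunc.coe_indicatorConst]
      ext1
      filter_upwards [(B f).coeFn_compLp (indicatorConstLp p hs hμs.ne c),
        indicatorConstLp_coeFn (p := p) (hs := hs) (hμs := hμs.ne) (c := c),
        indicatorConstLp_coeFn (p := p) (hs := hs) (hμs := hμs.ne) (c := (1 : 𝕜)),
        Lp.coeFn_smul (B f c) (indicatorConstLp p hs hμs.ne (1 : 𝕜))] with x h1 h2 h3 h4
      rw [h1, h2, h4, Pi.smul_apply, h3]
      by_cases hx : x ∈ s <;> simp [hx]
    rw [h, ContinuousLinearMap.coe_comp]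
    exact (isCompactOperator_id.continuous_comp
      (ContinuousLinearMap.toSpanSingleton 𝕜 _).continuous).comp_clm (B.flip c)
  | add hf hg _ h1 h2 =>
    rw [map_add]
    exact h1.add h2
  | isClosed =>
    exact isClosed_setOfPred_isCompactOperator.preimage (B.compLpL₂ p μ).flip.continuous

/-! ### Estimates for the Macdonald function -/

theorem rpow_mul_exp_neg_le {s t : ℝ} (hs : 0 < s) (ht : 0 < t) :
    t ^ s * Real.exp (-t) ≤ (2 * s) ^ s * Real.exp (-t / 2) := by
  have h1 : t / (2 * s) ≤ Real.exp (t / (2 * s)) := by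
    linarith [Real.add_one_le_exp (t / (2 * s))]
  have h2 : (t / (2 * s)) ^ s ≤ Real.exp (t / 2) := by
    refine (Real.rpow_le_rpow (by positivity) h1 hs.le).trans_eq ?_
    rw [← Real.exp_mul]
    congr 1
    field_simp
  rw [Real.div_rpow ht.le (by positivity), div_le_iff₀ (by positivity)] at h2
  calc t ^ s * Real.exp (-t) ≤ (Real.exp (t / 2) * (2 * s) ^ s) * Real.exp (-t) := by gcongr
    _ = (2 * s) ^ s * (Real.exp (t / 2) * Real.exp (-t)) := by ring
    _ = _ := by rw [← Real.exp_add]; ring_nf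

/-- The pointwise majorant behind all estimates of `macdonaldK`: the loss of `x ^ (-2 * δ)` over the
sharp order at zero pays for integrability in `u` when `a = 0`. -/
theorem exists_exp_neg_mul_cosh_le {a δ : ℝ} (ha : 0 ≤ a) (hδ : 0 < δ) :
    ∃ C, 0 ≤ C ∧ ∀ x u : ℝ, 0 < x → 0 ≤ u →
      (1 + x * Real.cosh u) * (1 + u) * (Real.exp (-x * Real.cosh u) * Real.exp (a * u)) ≤
        C * (x ^ (-(a + 2 * δ)) * Real.exp (-x / 2)) * Real.exp (-δ * u) := by
  set s := a + 2 * δ with hs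
  have hs0 : 0 < s := by positivity
  refine ⟨(1 + 1 / δ) * 2 ^ s * ((2 * s) ^ s + (2 * (s + 1)) ^ (s + 1)), by positivity, ?_⟩
  intro x u hx hu
  have hc : 1 ≤ Real.cosh u := Real.one_le_cosh u
  set t := x * Real.cosh u with ht
  have hxt : x ≤ t := le_mul_of_one_le_right hx.le hc
  have ht0 : 0 < t := hx.trans_le hxt
  have h1 : 1 + u ≤ (1 + 1 / δ) * Real.exp (δ * u) := by
    have e1 : 1 ≤ Real.exp (δ * u) := Real.one_le_exp (by positivity)
    have e2 : δ * u ≤ Real.exp (δ * u) := by linarith [Real.add_one_le_exp (δ * u)]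
    have e3 : u ≤ 1 / δ * Real.exp (δ * u) := by
      rw [one_div, inv_mul_eq_div, le_div_iff₀ hδ]; linarith
    linarith
  have h2 : Real.exp (s * u) ≤ 2 ^ s * x ^ (-s) * t ^ s := by
    have : Real.exp u ≤ 2 * x⁻¹ * t := by
      rw [ht, show 2 * x⁻¹ * (x * Real.cosh u) = 2 * Real.cosh u by field_simp, Real.cosh_eq]
      linarith [Real.exp_pos (-u)]
    calc Real.exp (s * u) = Real.exp u ^ s := by rw [← Real.exp_mul, mul_comm]
      _ ≤ (2 * x⁻¹ * t) ^ s := Real.rpow_le_rpow (Real.exp_pos _).le this hs0.le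
      _ = _ := by
        rw [Real.mul_rpow (by positivity) ht0.le, Real.mul_rpow (by norm_num) (by positivity),
          Real.inv_rpow hx.le, Real.rpow_neg hx.le]
  have h3 : (1 + t) * (t ^ s * Real.exp (-t)) ≤
      ((2 * s) ^ s + (2 * (s + 1)) ^ (s + 1)) * Real.exp (-x / 2) := by
    have e1 := rpow_mul_exp_neg_le hs0 ht0
    have e2 := rpow_mul_exp_neg_le (by positivity : 0 < s + 1) ht0
    have e3 : Real.exp (-t / 2) ≤ Real.exp (-x / 2) := Real.exp_le_exp.2 (by linarith)
    calc (1 + t) * (t ^ s * Real.exp (-t)) = t ^ s * Real.exp (-t) + t ^ (s + 1) * Real.exp (-t) := by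
          rw [Real.rpow_add_one ht0.ne']; ring
      _ ≤ ((2 * s) ^ s + (2 * (s + 1)) ^ (s + 1)) * Real.exp (-t / 2) := by linarith
      _ ≤ _ := by gcongr
  have h4 : Real.exp (a * u) * Real.exp (δ * u) = Real.exp (s * u) * Real.exp (-δ * u) := by
    rw [← Real.exp_add, ← Real.exp_add]; congr 1; rw [hs]; ring
  calc (1 + t) * (1 + u) * (Real.exp (-x * Real.cosh u) * Real.exp (a * u))
      = (1 + t) * (1 + u) * (Real.exp (-t) * Real.exp (a * u)) := by rw [ht, neg_mul]
    _ ≤ (1 + t) * ((1 + 1 / δ) * Real.exp (δ * u)) * (Real.exp (-t) * Real.exp (a * u)) := by gcongr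
    _ = (1 + 1 / δ) * (1 + t) * Real.exp (-t) * (Real.exp (a * u) * Real.exp (δ * u)) := by ring
    _ = (1 + 1 / δ) * (1 + t) * Real.exp (-t) * Real.exp (-δ * u) * Real.exp (s * u) := by
        rw [h4]; ring
    _ ≤ (1 + 1 / δ) * (1 + t) * Real.exp (-t) * Real.exp (-δ * u) *
          (2 ^ s * x ^ (-s) * t ^ s) := by gcongr
    _ = (1 + 1 / δ) * 2 ^ s * x ^ (-s) * Real.exp (-δ * u) *
          ((1 + t) * (t ^ s * Real.exp (-t))) := by ring
    _ ≤ (1 + 1 / δ) * 2 ^ s * x ^ (-s) * Real.exp (-δ * u) *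
          (((2 * s) ^ s + (2 * (s + 1)) ^ (s + 1)) * Real.exp (-x / 2)) := by gcongr
    _ = _ := by ring

theorem norm_cexp_neg_mul_cosh (x u : ℝ) :
    ‖Complex.exp (-(x : ℂ) * Complex.cosh (u : ℂ))‖ = Real.exp (-x * Real.cosh u) := by
  rw [Complex.norm_exp, ← Complex.ofReal_cosh, ← Complex.ofReal_neg, ← Complex.ofReal_mul,
    Complex.ofReal_re]

theorem norm_cosh_le_exp_re {z : ℂ} (hz : 0 ≤ z.re) : ‖Complex.cosh z‖ ≤ Real.exp z.re := by
  rw [Complex.cosh, norm_div, Complex.norm_ofNat, div_le_iff₀ two_pos]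
  refine (norm_add_le _ _).trans ?_
  rw [Complex.norm_exp, Complex.norm_exp, Complex.neg_re]
  linarith [Real.exp_le_exp.2 (by linarith : -z.re ≤ z.re)]

theorem norm_sinh_le_exp_re {z : ℂ} (hz : 0 ≤ z.re) : ‖Complex.sinh z‖ ≤ Real.exp z.re := by
  rw [Complex.sinh, norm_div, Complex.norm_ofNat, div_le_iff₀ two_pos]
  refine (norm_sub_le _ _).trans ?_
  rw [Complex.norm_exp, Complex.norm_exp, Complex.neg_re]
  linarith [Real.exp_le_exp.2 (by linarith : -z.re ≤ z.re)]

theorem norm_cexp_sub_cexp_le {z w : ℂ} (h : z.re = w.re) :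
    ‖Complex.exp z - Complex.exp w‖ ≤ Real.exp w.re * |z.im - w.im| := by
  have : Complex.exp z - Complex.exp w =
      Complex.exp w * (Complex.exp (Complex.I * ((z.im - w.im : ℝ) : ℂ)) - 1) := by
    rw [mul_sub, ← Complex.exp_add, mul_one]
    congr 2
    apply Complex.ext <;> simp [h]
  rw [this, norm_mul, Complex.norm_exp]
  gcongr
  exact Real.norm_exp_I_mul_ofReal_sub_one_le

theorem norm_cosh_sub_cosh_le {z w : ℂ} (h : z.re = w.re) (hw : 0 ≤ w.re) :
    ‖Complex.cosh z - Complex.cosh w‖ ≤ Real.exp w.re * |z.im - w.im| := by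
  have h1 := norm_cexp_sub_cexp_le h
  have h2 : ‖Complex.exp (-z) - Complex.exp (-w)‖ ≤ Real.exp w.re * |z.im - w.im| := by
    refine (norm_cexp_sub_cexp_le (by simp [h])).trans ?_
    rw [Complex.neg_im, Complex.neg_im, Complex.neg_re, show -z.im - -w.im = -(z.im - w.im) by ring,
      abs_neg]
    gcongr
    linarith
  have : Complex.cosh z - Complex.cosh w =
      ((Complex.exp z - Complex.exp w) + (Complex.exp (-z) - Complex.exp (-w))) / 2 := by
    rw [Complex.cosh, Complex.cosh]; ring
  rw [this, norm_div, Complex.norm_ofNat, div_le_iff₀ two_pos]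
  refine (norm_add_le _ _).trans ?_
  linarith

/-- On every vertical line of orders, `macdonaldK` is bounded, Lipschitz in the order, and decays at
least like the inverse of the order, with a common weight in `x`. -/
theorem exists_norm_macdonaldK_le {a δ : ℝ} (ha : 0 ≤ a) (hδ : 0 < δ) :
    ∃ C, 0 ≤ C ∧ ∀ x : ℝ, 0 < x → ∀ μ : ℂ, μ.re = a →
      ‖macdonaldK μ x‖ ≤ C * (x ^ (-(a + 2 * δ)) * Real.exp (-x / 2)) ∧
      ‖μ‖ * ‖macdonaldK μ x‖ ≤ C * (x ^ (-(a + 2 * δ)) * Real.exp (-x / 2)) ∧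
      ∀ μ' : ℂ, μ'.re = a → ‖macdonaldK μ x - macdonaldK μ' x‖ ≤
        |μ.im - μ'.im| * (C * (x ^ (-(a + 2 * δ)) * Real.exp (-x / 2))) := by
  obtain ⟨C, hC, hmaj⟩ := exists_exp_neg_mul_cosh_le ha hδ
  refine ⟨C / δ, by positivity, ?_⟩
  intro x hx
  set W := x ^ (-(a + 2 * δ)) * Real.exp (-x / 2) with hW
  have hW0 : 0 ≤ W := by positivity
  have hint : ∀ c : ℝ, IntegrableOn (fun u : ℝ => c * Real.exp (-δ * u)) (Ioi 0) := fun c =>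
    (integrableOn_exp_mul_Ioi (neg_lt_zero.2 hδ) 0).const_mul c
  have hval : ∀ c : ℝ, ∫ u in Ioi (0 : ℝ), c * Real.exp (-δ * u) = c / δ := fun c => by
    rw [integral_const_mul, integral_exp_mul_Ioi (neg_lt_zero.2 hδ)]
    simp [div_eq_mul_inv]
  have hb : ∀ u : ℝ, 0 < u → Real.exp (-x * Real.cosh u) * Real.exp (a * u) ≤
      C * W * Real.exp (-δ * u) ∧ u * (Real.exp (-x * Real.cosh u) * Real.exp (a * u)) ≤
      C * W * Real.exp (-δ * u) ∧
      x * Real.cosh u * (Real.exp (-x * Real.cosh u) * Real.exp (a * u)) ≤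
      C * W * Real.exp (-δ * u) := by
    intro u hu
    have h := hmaj x u hx hu.le
    have hc := Real.cosh_pos u
    set y := Real.exp (-x * Real.cosh u) * Real.exp (a * u)
    have hy : 0 ≤ y := by positivity
    refine ⟨le_trans ?_ h, le_trans ?_ h, le_trans ?_ h⟩
    · refine le_mul_of_one_le_left hy ?_
      nlinarith [mul_pos hx hc, mul_pos (mul_pos hx hc) hu]
    · refine mul_le_mul_of_nonneg_right ?_ hy
      nlinarith [mul_pos hx hc, mul_pos (mul_pos hx hc) hu]
    · refine mul_le_mul_of_nonneg_right ?_ hy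
      nlinarith [mul_pos hx hc, mul_pos (mul_pos hx hc) hu]
  have hre : ∀ μ : ℂ, μ.re = a → ∀ u : ℝ, (μ * u).re = a * u := by
    intro μ hμ u; simp [hμ]
  have hI : ∀ μ : ℂ, μ.re = a → ∀ u ∈ Ioi (0 : ℝ),
      ‖Complex.exp (-(x : ℂ) * Complex.cosh (u : ℂ)) * Complex.cosh (μ * (u : ℂ))‖ ≤
        C * W * Real.exp (-δ * u) := by
    intro μ hμ u hu
    refine le_trans ?_ (hb u hu).1
    rw [norm_mul, norm_cexp_neg_mul_cosh]
    gcongr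
    rw [← hre μ hμ u]
    exact norm_cosh_le_exp_re (by rw [hre μ hμ u]; exact mul_nonneg ha (le_of_lt hu))
  have hInt : ∀ μ : ℂ, μ.re = a → IntegrableOn (fun u : ℝ =>
      Complex.exp (-(x : ℂ) * Complex.cosh (u : ℂ)) * Complex.cosh (μ * (u : ℂ))) (Ioi 0) := by
    intro μ hμ
    refine (hint (C * W)).mono' (Continuous.aestronglyMeasurable (by fun_prop)) ?_
    exact (ae_restrict_iff' measurableSet_Ioi).2 (.of_forall (hI μ hμ))
  have hbound : ∀ F : ℝ → ℂ, (∀ u ∈ Ioi (0 : ℝ), ‖F u‖ ≤ C * W * Real.exp (-δ * u)) →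
      ‖∫ u in Ioi (0 : ℝ), F u‖ ≤ C / δ * W := by
    intro F hF
    refine (norm_integral_le_of_norm_le (hint (C * W))
      ((ae_restrict_iff' measurableSet_Ioi).2 (.of_forall hF))).trans_eq ?_
    rw [hval]; ring
  intro μ hμ
  refine ⟨hbound _ (hI μ hμ), ?_, ?_⟩
  · -- one integration by parts gains the factor `‖μ‖`
    set E : ℝ → ℂ := fun u => Complex.exp (-(x : ℂ) * Complex.cosh (u : ℂ))
    set G : ℝ → ℂ := fun u => E u * Complex.sinh (μ * u) with hG
    set R : ℝ → ℂ := fun u => x * Complex.sinh (u : ℂ) * (E u * Complex.sinh (μ * u)) with hR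
    have hGb : ∀ u ∈ Ioi (0 : ℝ), ‖G u‖ ≤ Real.exp (-x * Real.cosh u) * Real.exp (a * u) := by
      intro u hu
      rw [hG, norm_mul, norm_cexp_neg_mul_cosh]
      gcongr
      rw [← hre μ hμ u]
      exact norm_sinh_le_exp_re (by rw [hre μ hμ u]; exact mul_nonneg ha (le_of_lt hu))
    have hRb : ∀ u ∈ Ioi (0 : ℝ), ‖R u‖ ≤ C * W * Real.exp (-δ * u) := by
      intro u hu
      refine le_trans ?_ (hb u hu).2.2
      have h1 : ‖(x : ℂ) * Complex.sinh (u : ℂ)‖ ≤ x * Real.cosh u := by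
        rw [norm_mul, Complex.norm_real, Real.norm_of_nonneg hx.le, ← Complex.ofReal_sinh,
          Complex.norm_real, Real.norm_of_nonneg (Real.sinh_nonneg_iff.2 (le_of_lt hu))]
        gcongr
        exact (Real.sinh_lt_cosh u).le
      calc ‖R u‖ = ‖(x : ℂ) * Complex.sinh (u : ℂ)‖ * ‖G u‖ := by rw [hR, hG, norm_mul]
        _ ≤ _ := mul_le_mul h1 (hGb u hu) (norm_nonneg _) (by positivity)
    have hRint : IntegrableOn R (Ioi 0) := by
      refine (hint (C * W)).mono' (Continuous.aestronglyMeasurable (by fun_prop)) ?_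
      exact (ae_restrict_iff' measurableSet_Ioi).2 (.of_forall hRb)
    have hder : ∀ u ∈ Ici (0 : ℝ), HasDerivAt G (μ * (E u * Complex.cosh (μ * u)) - R u) u := by
      intro u _
      have e2 : HasDerivAt (fun u : ℝ => Complex.exp (-(x : ℂ) * Complex.cosh (u : ℂ)))
          (Complex.exp (-(x : ℂ) * Complex.cosh (u : ℂ)) * (-(x : ℂ) * Complex.sinh (u : ℂ))) u :=
        ((Complex.hasDerivAt_cosh (u : ℂ)).const_mul (-(x : ℂ))).cexp.comp_ofReal
      have e3 : HasDerivAt (fun u : ℝ => Complex.sinh (μ * (u : ℂ)))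
          (Complex.cosh (μ * u) * (μ * 1)) u :=
        ((hasDerivAt_id (u : ℂ)).const_mul μ).csinh.comp_ofReal
      refine (e2.mul e3).congr_deriv ?_
      simp only [hR, E]
      ring
    have hlim : Filter.Tendsto G Filter.atTop (nhds 0) := by
      have : Filter.Tendsto (fun u : ℝ => C * W * Real.exp (-δ * u)) Filter.atTop (nhds 0) := by
        rw [← mul_zero (C * W)]
        refine Filter.Tendsto.const_mul _ (Real.tendsto_exp_atBot.comp ?_)
        exact Filter.tendsto_id.const_mul_atTop_of_neg (neg_lt_zero.2 hδ)
      refine squeeze_zero_norm' ?_ this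
      filter_upwards [Filter.eventually_gt_atTop 0] with u hu
      exact (hGb u hu).trans (hb u hu).1
    have hibp := integral_Ioi_of_hasDerivAt_of_tendsto' hder
      (((hInt μ hμ).const_mul μ).sub hRint) hlim
    rw [integral_sub ((hInt μ hμ).const_mul μ) hRint, integral_const_mul] at hibp
    have hG0 : G 0 = 0 := by simp [hG]
    rw [hG0, sub_zero, sub_eq_zero] at hibp
    rw [← norm_mul, macdonaldK, hibp]
    exact hbound R hRb
  · intro μ' hμ'
    rw [macdonaldK, macdonaldK, ← integral_sub (hInt μ hμ) (hInt μ' hμ')]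
    refine (norm_integral_le_of_norm_le (hint (|μ.im - μ'.im| * (C * W))) ?_).trans_eq ?_
    · refine (ae_restrict_iff' measurableSet_Ioi).2 (.of_forall fun u hu => ?_)
      have hu' : 0 ≤ u := le_of_lt hu
      have h1 : ‖Complex.cosh (μ * u) - Complex.cosh (μ' * u)‖ ≤
          Real.exp (a * u) * (|μ.im - μ'.im| * u) := by
        have := norm_cosh_sub_cosh_le (z := μ * u) (w := μ' * u)
          (by rw [hre μ hμ, hre μ' hμ']) (by rw [hre μ' hμ']; positivity)
        refine this.trans_eq ?_
        rw [hre μ' hμ']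
        simp only [Complex.im_mul_ofReal]
        rw [← sub_mul, abs_mul, abs_of_nonneg hu']
      rw [← mul_sub, norm_mul, norm_cexp_neg_mul_cosh]
      calc _ ≤ Real.exp (-x * Real.cosh u) * (Real.exp (a * u) * (|μ.im - μ'.im| * u)) := by gcongr
        _ = |μ.im - μ'.im| * (u * (Real.exp (-x * Real.cosh u) * Real.exp (a * u))) := by ring
        _ ≤ |μ.im - μ'.im| * (C * W * Real.exp (-δ * u)) := by
            exact mul_le_mul_of_nonneg_left (hb u hu).2.1 (abs_nonneg _)
        _ = _ := by ring
    · rw [hval]; ring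

/-! ### The Lebedev kernel as a curve in a weighted Lebesgue space -/

theorem exists_lebedevKernel_le {α b : ℝ} (hα : 0 ≤ α) (hb : α < b) :
    ∃ C, 0 ≤ C ∧ ∀ x : ℝ, 0 < x → ∀ τ : ℝ,
      lebedevKernel α τ x ≤ C * (1 + τ ^ 2)⁻¹ * (x ^ (-b) * Real.exp (-x)) ∧
      ∀ τ' : ℝ, |lebedevKernel α τ x - lebedevKernel α τ' x| ≤
        C * |τ - τ'| * (x ^ (-b) * Real.exp (-x)) := by
  obtain ⟨C, hC, h⟩ := exists_norm_macdonaldK_le (a := α / 2) (δ := (b - α) / 4)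
    (by positivity) (by linarith)
  refine ⟨5 * C ^ 2, by positivity, fun x hx τ => ?_⟩
  set W := x ^ (-(α / 2 + 2 * ((b - α) / 4))) * Real.exp (-x / 2) with hW
  have hW2 : W ^ 2 = x ^ (-b) * Real.exp (-x) := by
    rw [hW, mul_pow, ← Real.rpow_natCast, ← Real.rpow_mul hx.le, ← Real.exp_nat_mul]
    congr 2 <;> push_cast <;> ring
  have hW0 : 0 ≤ W := by positivity
  have hre : ∀ τ : ℝ, ((Complex.I * (τ : ℂ) + (α : ℂ)) / 2).re = α / 2 := fun τ => by simp
  have him : ∀ τ : ℝ, ((Complex.I * (τ : ℂ) + (α : ℂ)) / 2).im = τ / 2 := fun τ => by simp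
  rw [← hW2]
  obtain ⟨h1, h2, h3⟩ := h x hx _ (hre τ)
  constructor
  · unfold lebedevKernel
    set k := ‖macdonaldK ((Complex.I * (τ : ℂ) + (α : ℂ)) / 2) x‖
    have hk : 0 ≤ k := norm_nonneg _
    have h4 : |τ| / 2 * k ≤ C * W := by
      refine le_trans ?_ h2
      gcongr
      have := Complex.abs_im_le_norm ((Complex.I * (τ : ℂ) + (α : ℂ)) / 2)
      rwa [him, abs_div, abs_of_pos (two_pos : (0 : ℝ) < 2)] at this
    have h5 : k ^ 2 ≤ (C * W) ^ 2 := by gcongr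
    have h6 : (|τ| / 2 * k) ^ 2 ≤ (C * W) ^ 2 := by gcongr
    rw [mul_pow, div_pow, sq_abs] at h6
    rw [show 5 * C ^ 2 * (1 + τ ^ 2)⁻¹ * W ^ 2 = (5 * (C * W) ^ 2) / (1 + τ ^ 2) by ring,
      le_div_iff₀ (by positivity)]
    linarith
  · intro τ'
    have h7 := h3 _ (hre τ')
    have h8 := (h x hx _ (hre τ')).1
    rw [him, him, ← sub_div, abs_div, abs_of_pos (two_pos : (0 : ℝ) < 2)] at h7
    unfold lebedevKernel
    set K := macdonaldK ((Complex.I * (τ : ℂ) + (α : ℂ)) / 2) x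
    set K' := macdonaldK ((Complex.I * (τ' : ℂ) + (α : ℂ)) / 2) x
    have h9 : |‖K‖ - ‖K'‖| ≤ |τ - τ'| / 2 * (C * W) := (abs_norm_sub_norm_le K K').trans h7
    calc |‖K‖ ^ 2 - ‖K'‖ ^ 2| = |‖K‖ - ‖K'‖| * (‖K‖ + ‖K'‖) := by
          rw [sq_sub_sq, abs_mul, abs_of_nonneg (by positivity : 0 ≤ ‖K‖ + ‖K'‖), mul_comm]
      _ ≤ |τ - τ'| / 2 * (C * W) * (C * W + C * W) := by gcongr
      _ = C ^ 2 * |τ - τ'| * W ^ 2 := by ring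
      _ ≤ _ := by gcongr; linarith [sq_nonneg C]

theorem measurable_lebedevKernel (α τ : ℝ) : Measurable (lebedevKernel α τ) := by
  have h : StronglyMeasurable fun x : ℝ =>
      macdonaldK ((Complex.I * (τ : ℂ) + (α : ℂ)) / 2) (x : ℂ) := by
    unfold macdonaldK
    refine StronglyMeasurable.integral_prod_right
      (f := fun x u : ℝ => Complex.exp (-(x : ℂ) * Complex.cosh (u : ℂ)) *
        Complex.cosh ((Complex.I * (τ : ℂ) + (α : ℂ)) / 2 * (u : ℂ))) ?_
    refine Continuous.stronglyMeasurable ?_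
    unfold Function.uncurry
    fun_prop
  exact h.norm.measurable.pow_const 2

theorem weightedMeasure_ae_pos (ν p : ℝ) : ∀ᵐ x ∂weightedMeasure ν p, 0 < x :=
  (withDensity_absolutelyContinuous _ _).ae_le (ae_restrict_mem measurableSet_Ioi)

theorem measurable_weight (ν p : ℝ) :
    Measurable fun x : ℝ => ENNReal.ofReal (x ^ (ν * p - 1)) := by fun_prop

theorem integrable_weightedMeasure_iff {E : Type*} [NormedAddCommGroup E] [NormedSpace ℝ E]
    {ν p : ℝ} {g : ℝ → E} :
    Integrable g (weightedMeasure ν p) ↔ IntegrableOn (fun x => x ^ (ν * p - 1) • g x) (Ioi 0) := by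
  rw [weightedMeasure, integrable_withDensity_iff_integrable_smul' (measurable_weight ν p)
    (.of_forall fun _ => ENNReal.ofReal_lt_top)]
  refine integrableOn_congr_fun (fun x hx => ?_) measurableSet_Ioi
  rw [ENNReal.toReal_ofReal (Real.rpow_nonneg (le_of_lt hx) _)]

theorem integral_weightedMeasure {E : Type*} [NormedAddCommGroup E] [NormedSpace ℝ E]
    {ν p : ℝ} (g : ℝ → E) :
    ∫ x, g x ∂weightedMeasure ν p = ∫ x in Ioi 0, x ^ (ν * p - 1) • g x := by
  rw [weightedMeasure, integral_withDensity_eq_integral_toReal_smul (measurable_weight ν p)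
    (.of_forall fun _ => ENNReal.ofReal_lt_top)]
  refine setIntegral_congr_fun measurableSet_Ioi fun x hx => ?_
  rw [ENNReal.toReal_ofReal (Real.rpow_nonneg (le_of_lt hx) _)]

/-- The product `x ^ (-b) * exp (-x)` that dominates the Lebedev kernel, divided by the density of
`weightedMeasure ν p`. -/
noncomputable def weightedMajorant (ν p b x : ℝ) : ℝ := x ^ (-b) * Real.exp (-x) * x ^ (1 - ν * p)

theorem memLp_weightedMajorant {p q ν b : ℝ} (hpq : p.HolderConjugate q) (hb : b + ν < 1) :
    MemLp (weightedMajorant ν p b) (ENNReal.ofReal q) (weightedMeasure ν p) := by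
  have hq : 0 < q := hpq.symm.pos
  have hmeas : Measurable (weightedMajorant ν p b) := by unfold weightedMajorant; fun_prop
  rw [← integrable_norm_rpow_iff hmeas.aestronglyMeasurable (by simpa using hq)
    ENNReal.ofReal_ne_top, ENNReal.toReal_ofReal hq.le, integrable_weightedMeasure_iff]
  have h := integrableOn_rpow_mul_exp_neg_mul_rpow (p := 1) (s := q * (1 - b - ν) - 1) (b := q)
    (by nlinarith) one_pos hq
  refine h.congr_fun (fun x hx => ?_) measurableSet_Ioi
  have hx : 0 < x := hx
  simp only [Real.rpow_one, smul_eq_mul, weightedMajorant]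
  rw [Real.norm_of_nonneg (by positivity), Real.mul_rpow (by positivity) (by positivity),
    Real.mul_rpow (by positivity) (by positivity), ← Real.rpow_mul hx.le, ← Real.rpow_mul hx.le,
    ← Real.exp_mul]
  have e : q * (1 - b - ν) - 1 = (ν * p - 1) + (-b * q) + ((1 - ν * p) * q) := by
    linear_combination ν * hpq.mul_eq_add
  rw [e, Real.rpow_add hx, Real.rpow_add hx, show -q * x = -x * q by ring]
  ring

/-- The kernel `lebedevKernel α τ` divided by the density of `weightedMeasure ν p`, so that its
pairing with `f` against that measure is `lebedevTransform α f τ`. -/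
noncomputable def weightedKernel (𝕜 : Type*) [RCLike 𝕜] (α ν p τ x : ℝ) : 𝕜 :=
  ((lebedevKernel α τ x * x ^ (1 - ν * p) : ℝ) : 𝕜)

section

variable {𝕜 : Type*} [RCLike 𝕜]

theorem rpow_smul_weightedKernel_mul (α ν p τ : ℝ) {x : ℝ} (hx : 0 < x) (c : 𝕜) :
    x ^ (ν * p - 1) • (weightedKernel 𝕜 α ν p τ x * c) = lebedevKernel α τ x • c := by
  have h : x ^ (ν * p - 1) * x ^ (1 - ν * p) = 1 := by
    rw [← Real.rpow_add hx]; simp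
  rw [weightedKernel, RCLike.real_smul_eq_coe_mul, RCLike.real_smul_eq_coe_mul, ← mul_assoc,
    ← RCLike.ofReal_mul]
  congr 2
  linear_combination lebedevKernel α τ x * h

theorem aestronglyMeasurable_weightedKernel (α ν p τ : ℝ) (m : Measure ℝ) :
    AEStronglyMeasurable (weightedKernel 𝕜 α ν p τ) m := by
  have := measurable_lebedevKernel α τ
  unfold weightedKernel
  exact Measurable.aestronglyMeasurable (by fun_prop)

theorem exists_weightedKernel_le {α b : ℝ} (hα : 0 ≤ α) (hb : α < b) (ν p : ℝ) :
    ∃ C, 0 ≤ C ∧ ∀ τ : ℝ,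
      (∀ᵐ x ∂weightedMeasure ν p, ‖weightedKernel 𝕜 α ν p τ x‖ ≤
        C * (1 + τ ^ 2)⁻¹ * ‖weightedMajorant ν p b x‖) ∧
      ∀ τ' : ℝ, ∀ᵐ x ∂weightedMeasure ν p,
        ‖weightedKernel 𝕜 α ν p τ x - weightedKernel 𝕜 α ν p τ' x‖ ≤
          C * |τ - τ'| * ‖weightedMajorant ν p b x‖ := by
  obtain ⟨C, hC, h⟩ := exists_lebedevKernel_le hα hb
  have hmaj : ∀ x : ℝ, 0 < x →
      ‖weightedMajorant ν p b x‖ = x ^ (-b) * Real.exp (-x) * x ^ (1 - ν * p) := fun x hx =>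
    Real.norm_of_nonneg (by unfold weightedMajorant; positivity)
  refine ⟨C, hC, fun τ => ⟨?_, fun τ' => ?_⟩⟩
  · filter_upwards [weightedMeasure_ae_pos ν p] with x hx
    have hk : 0 ≤ lebedevKernel α τ x := sq_nonneg _
    rw [weightedKernel, RCLike.norm_ofReal, abs_of_nonneg (by positivity), hmaj x hx, ← mul_assoc]
    gcongr
    exact (h x hx τ).1
  · filter_upwards [weightedMeasure_ae_pos ν p] with x hx
    rw [weightedKernel, weightedKernel, ← RCLike.ofReal_sub, RCLike.norm_ofReal, ← sub_mul, abs_mul,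
      abs_of_nonneg (by positivity : 0 ≤ x ^ (1 - ν * p)), hmaj x hx, ← mul_assoc]
    gcongr
    exact (h x hx τ).2 τ'

theorem memLp_inv_one_add_sq {q : ℝ} (hq : 1 ≤ q) :
    MemLp (fun τ : ℝ => (1 + τ ^ 2)⁻¹) (ENNReal.ofReal q) volume := by
  have hq0 : 0 < q := by linarith
  have hc : Continuous fun τ : ℝ => (1 + τ ^ 2)⁻¹ :=
    Continuous.inv₀ (by fun_prop) fun τ => by positivity
  rw [← integrable_norm_rpow_iff hc.aestronglyMeasurable (by simpa using hq0)
    ENNReal.ofReal_ne_top, ENNReal.toReal_ofReal hq0.le]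
  refine integrable_inv_one_add_sq.mono'
    ((hc.norm.rpow_const fun _ => .inr hq0.le).aestronglyMeasurable) (.of_forall fun τ => ?_)
  rw [Real.norm_of_nonneg (by positivity), Real.norm_of_nonneg (by positivity)]
  refine (Real.rpow_le_rpow_of_exponent_ge (by positivity) ?_ hq).trans_eq (Real.rpow_one _)
  exact inv_le_one_of_one_le₀ (by nlinarith [sq_nonneg τ])

/-- The curve of kernels `τ ↦ weightedKernel 𝕜 α ν p τ` takes values in the dual `L^q` space, is
Lipschitz there, and is dominated by `(1 + τ ^ 2)⁻¹`, so it is itself `q`-integrable. -/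
theorem exists_memLp_weightedKernel {p q α ν : ℝ} [Fact (1 ≤ ENNReal.ofReal q)]
    (hpq : p.HolderConjugate q) (hα : 0 ≤ α) (hαν : α + ν < 1) :
    ∃ g : ℝ → Lp 𝕜 (ENNReal.ofReal q) (weightedMeasure ν p),
      (∀ τ, g τ =ᵐ[weightedMeasure ν p] weightedKernel 𝕜 α ν p τ) ∧
      MemLp g (ENNReal.ofReal q) volume := by
  obtain ⟨b, hb1, hb2⟩ : ∃ b, α < b ∧ b < 1 - ν := exists_between (by linarith)
  obtain ⟨C, hC, h⟩ := exists_weightedKernel_le (𝕜 := 𝕜) hα hb1 ν p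
  have hM := memLp_weightedMajorant hpq (by linarith : b + ν < 1)
  have hmem : ∀ τ, MemLp (weightedKernel 𝕜 α ν p τ) (ENNReal.ofReal q) (weightedMeasure ν p) :=
    fun τ => hM.of_le_mul (aestronglyMeasurable_weightedKernel α ν p τ _) (h τ).1
  set D := hM.toLp with hD
  set g := fun τ => (hmem τ).toLp with hg
  have hnorm : ∀ τ, ‖g τ‖ ≤ C * (1 + τ ^ 2)⁻¹ * ‖D‖ := fun τ => by
    refine Lp.norm_le_mul_norm_of_ae_le_mul ?_
    filter_upwards [(h τ).1, (hmem τ).coeFn_toLp, hM.coeFn_toLp] with x h1 h2 h3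
    rwa [h2, h3]
  have hlip : LipschitzWith (C * ‖D‖).toNNReal g := by
    refine LipschitzWith.of_dist_le_mul fun τ τ' => ?_
    rw [Real.coe_toNNReal _ (by positivity), dist_eq_norm, Real.dist_eq,
      show C * ‖D‖ * |τ - τ'| = C * |τ - τ'| * ‖D‖ by ring]
    refine Lp.norm_le_mul_norm_of_ae_le_mul ?_
    filter_upwards [(h τ).2 τ', (hmem τ).coeFn_toLp, (hmem τ').coeFn_toLp, hM.coeFn_toLp,
      Lp.coeFn_sub (g τ) (g τ')] with x h1 h2 h3 h4 h5
    rwa [h5, Pi.sub_apply, h2, h3, h4]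
  refine ⟨g, fun τ => (hmem τ).coeFn_toLp, ?_⟩
  refine (memLp_inv_one_add_sq (q := q) hpq.symm.lt.le).of_le_mul (c := C * ‖D‖)
    hlip.continuous.aestronglyMeasurable (.of_forall fun τ => ?_)
  refine (hnorm τ).trans_eq ?_
  rw [Real.norm_of_nonneg (by positivity)]
  ring

end

/-! ### Compactness of the Lebedev transform -/

theorem theorem2 {𝕜 : Type*} [RCLike 𝕜] (p q α ν : ℝ)
    [Fact (1 ≤ ENNReal.ofReal p)] [Fact (1 ≤ ENNReal.ofReal q)]
    (hp : 1 < p) (hp2 : p ≤ 2) (hq : q = p / (p - 1))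
    (hα : 0 ≤ α) (hαν : α + ν < 1) :
    (∀ (f : WeightedLp 𝕜 ν p) (τ : ℝ),
      IntegrableOn (fun x => lebedevKernel α τ x • f x) (Ioi (0 : ℝ)) volume) ∧
    ∃ T : WeightedLp 𝕜 ν p →L[𝕜] Lp 𝕜 (ENNReal.ofReal q) (volume : Measure ℝ),
      (∀ f : WeightedLp 𝕜 ν p, T f =ᵐ[volume] lebedevTransform α f) ∧
      IsCompactOperator T := by
  have hpq : p.HolderConjugate q := (Real.holderConjugate_iff_eq_conjExponent hp).2 hq
  have : ENNReal.HolderConjugate (ENNReal.ofReal q) (ENNReal.ofReal p) := hpq.symm.ennrealOfReal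
  obtain ⟨g, hg, hgm⟩ := exists_memLp_weightedKernel (𝕜 := 𝕜) hpq hα hαν
  refine ⟨fun f τ => ?_, ?_⟩
  · have h := (ContinuousLinearMap.mul 𝕜 𝕜).memLp_of_bilin 1 (Lp.memLp (g τ)) (Lp.memLp f)
    rw [memLp_one_iff_integrable] at h
    have h' : Integrable (fun x => weightedKernel 𝕜 α ν p τ x * f x) (weightedMeasure ν p) := by
      refine h.congr ?_
      filter_upwards [hg τ] with x hx
      rw [ContinuousLinearMap.mul_apply', hx]
    exact (integrable_weightedMeasure_iff.1 h').congr_fun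
      (fun x hx => rpow_smul_weightedKernel_mul α ν p τ hx (f x)) measurableSet_Ioi
  · set B := ((ContinuousLinearMap.mul 𝕜 𝕜).lpPairing (weightedMeasure ν p)
      (ENNReal.ofReal q) (ENNReal.ofReal p)).flip with hB
    refine ⟨(B.compLpL₂ (ENNReal.ofReal q) volume).flip hgm.toLp, fun f => ?_,
      isCompactOperator_compLpL₂_flip ENNReal.ofReal_ne_top B _⟩
    rw [ContinuousLinearMap.flip_apply, ContinuousLinearMap.compLpL₂_apply_apply]
    filter_upwards [(B f).coeFn_compLp hgm.toLp, hgm.coeFn_toLp] with τ h1 h2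
    rw [h1, h2, hB, ContinuousLinearMap.flip_apply, ContinuousLinearMap.lpPairing_eq_integral]
    have : ∫ x, ContinuousLinearMap.mul 𝕜 𝕜 (g τ x) (f x) ∂weightedMeasure ν p =
        ∫ x, weightedKernel 𝕜 α ν p τ x * f x ∂weightedMeasure ν p := by
      refine integral_congr_ae ?_
      filter_upwards [hg τ] with x hx
      rw [ContinuousLinearMap.mul_apply', hx]
    rw [this, integral_weightedMeasure, lebedevTransform]
    exact setIntegral_congr_fun measurableSet_Ioi
      fun x hx => rpow_smul_weightedKernel_mul α ν p τ hx (f x)
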